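/- Let $K$ be an algebraically closed field of characteristic zero, let $n$ be a positive integer, let $P_n=K[x_1,\ldots,x_n]$, and let $W_n=\mathrm{Der}_K(P_n)$ be the Lie algebra of all $K$-derivations of $P_n$ (with the commutator bracket); for $1\le s\le n$ regard $P_s=K[x_1,\ldots,x_s]$ as a subring of $P_n$. (1) For every integer $s$ with $1\le s\le n-1$, the set $$m_s(K)=\Big\{\sum_{i=1}^s f_i\frac{\partial}{\partial x_i}+\sum_{j=s+1}^n g_j\frac{\partial}{\partial x_j}\ \Big|\ f_i\in P_s,\ g_j\in P_n\Big\}$$ is a maximal subalgebra of the Lie algebra $W_n$, that is, a proper Lie subalgebra not strictly contained in any other proper Lie subalgebra. (2) For every such $s$, the set $$I_s=\Big\{\sum_{j=s+1}^n g_j\frac{\partial}{\partial x_j}\ \Big|\ g_j\in P_n\Big\}$$ is a polynomial ideal of the Lie algebra $m_s(K)$, that is, an ideal of $m_s(K)$ which is also a $P_n$-submodule of $W_n$. As Lie algebras over $K$, $I_s\cong P_s\otimes_K W_{n-s}$, where $P_s\otimes_K W_{n-s}$ has the bracket $[f\otimes D,\,g\otimes E]=fg\otimes[D,E]$, and $m_s(K)/I_s\cong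 W_s$. (3) For every such $s$, $I_s$ is the unique nontrivial (that is, nonzero and proper) ideal of the Lie algebra $m_s(K)$. (4) For $s,t\in\{1,\ldots,n-1\}$ with $s\ne t$, the Lie algebras $m_s(K)$ and $m_t(K)$ are not isomorphic over $K$. -/

import Mathlib

open scoped TensorProduct

namespace PolyVectorFields

/-- The polynomial ring `P_n = K[x_1, …, x_n]`; the variable `x_{i+1}` is `MvPolynomial.X i`. -/
abbrev P (K : Type*) [Field K] (n : ℕ) := MvPolynomial (Fin n) K

/-- The Lie algebra `W_n` of all `K`-derivations of `P_n`, with the commutator bracket. -/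
abbrev W (K : Type*) [Field K] (n : ℕ) := Derivation K (P K n) (P K n)

/-- The subring `P_s = K[x_1, …, x_s]` of `P_n`. -/
noncomputable abbrev firstVars (K : Type*) [Field K] (n s : ℕ) : Subalgebra K (P K n) :=
  MvPolynomial.supported K {i : Fin n | i.val < s}

/-- `D` has the form `∑_{i ≤ s} f_i ∂/∂x_i + ∑_{j > s} g_j ∂/∂x_j` with `f_i ∈ P_s`, `g_j ∈ P_n`. -/
def IsInM {K : Type*} [Field K] {n : ℕ} (s : ℕ) (D : W K n) : Prop :=
  ∃ f g : Fin n → P K n, (∀ i : Fin n, i.val < s → f i ∈ firstVars K n s) ∧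
    D = ∑ i with i.val < s, f i • MvPolynomial.pderiv i
      + ∑ j with s ≤ j.val, g j • MvPolynomial.pderiv j

/-- `D` has the form `∑_{j > s} g_j ∂/∂x_j` with `g_j ∈ P_n`. -/
def IsInI {K : Type*} [Field K] {n : ℕ} (s : ℕ) (D : W K n) : Prop :=
  ∃ g : Fin n → P K n, D = ∑ j with s ≤ j.val, g j • MvPolynomial.pderiv j

section helpers

variable {K : Type*} [Field K] {n : ℕ}

lemma sum_pderiv_apply_X (t : Finset (Fin n)) (f : Fin n → P K n) (k : Fin n) :
    (∑ i ∈ t, f i • (MvPolynomial.pderiv i : W K n)) (MvPolynomial.X k)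
      = if k ∈ t then f k else 0 := by
  have h : ∀ i ∈ t, (f i • (MvPolynomial.pderiv i : W K n)) (MvPolynomial.X k)
      = if k = i then f i else 0 := by
    intro i _
    rw [Derivation.smul_apply, MvPolynomial.pderiv_X, Pi.single_apply]
    split_ifs <;> simp
  rw [← Derivation.coeFnAddMonoidHom_apply, map_sum, Finset.sum_apply]
  simp only [Derivation.coeFnAddMonoidHom_apply]
  rw [Finset.sum_congr rfl h, Finset.sum_ite_eq]

lemma isInM_iff (s : ℕ) (D : W K n) :
    IsInM s D ↔ ∀ i : Fin n, i.val < s → D (MvPolynomial.X i) ∈ firstVars K n s := by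
  constructor
  · rintro ⟨f, g, hf, rfl⟩ i hi
    rw [Derivation.add_apply, sum_pderiv_apply_X, sum_pderiv_apply_X]
    simpa [hi, Nat.not_le.2 hi] using hf i hi
  · intro h
    refine ⟨fun i => D (MvPolynomial.X i), fun i => D (MvPolynomial.X i), ?_, ?_⟩
    · intro i hi
      exact h i hi
    · refine MvPolynomial.derivation_ext fun k => ?_
      rw [Derivation.add_apply, sum_pderiv_apply_X, sum_pderiv_apply_X]
      by_cases hk : k.val < s
      · simp [hk, Nat.not_le.2 hk]
      · simp [hk, Nat.not_lt.1 hk]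

lemma isInI_iff (s : ℕ) (D : W K n) :
    IsInI s D ↔ ∀ i : Fin n, i.val < s → D (MvPolynomial.X i) = 0 := by
  constructor
  · rintro ⟨g, rfl⟩ i hi
    rw [sum_pderiv_apply_X]
    simp [hi]
  · intro h
    refine ⟨fun i => D (MvPolynomial.X i), MvPolynomial.derivation_ext fun k => ?_⟩
    rw [sum_pderiv_apply_X]
    by_cases hk : k.val < s
    · simp [h k hk]
    · simp [hk]

lemma IsInM.apply_mem {s : ℕ} {D : W K n} (hD : IsInM s D) {p : P K n}
    (hp : p ∈ firstVars K n s) : D p ∈ firstVars K n s := by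
  rw [isInM_iff] at hD
  induction hp using Algebra.adjoin_induction with
  | mem x hx => obtain ⟨i, hi, rfl⟩ := hx; exact hD i hi
  | algebraMap r => simp
  | add x y _ _ hx hy => rw [map_add]; exact add_mem hx hy
  | mul x y hx' hy' hx hy =>
    rw [Derivation.leibniz]
    exact add_mem (mul_mem hx' hy) (mul_mem hy' hx)

lemma IsInI.apply_eq_zero {s : ℕ} {D : W K n} (hD : IsInI s D) {p : P K n}
    (hp : p ∈ firstVars K n s) : D p = 0 := by
  rw [isInI_iff] at hD
  induction hp using Algebra.adjoin_induction with
  | mem x hx => obtain ⟨i, hi, rfl⟩ := hx; exact hD i hi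
  | algebraMap r => simp
  | add x y _ _ hx hy => rw [map_add, hx, hy, add_zero]
  | mul x y _ _ hx hy => rw [Derivation.leibniz, hx, hy, smul_zero, smul_zero, add_zero]

end helpers

/-- The Lie subalgebra `m_s(K)` of `W_n`. -/
def m (K : Type*) [Field K] (n s : ℕ) : LieSubalgebra K (W K n) where
  carrier := {D | IsInM s D}
  add_mem' {D E} hD hE := by
    simp only [Set.mem_ofPred_eq, isInM_iff] at hD hE ⊢
    intro i hi
    exact add_mem (hD i hi) (hE i hi)
  zero_mem' := by
    simp only [Set.mem_ofPred_eq, isInM_iff]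
    intro i _
    simp
  smul_mem' c D hD := by
    simp only [Set.mem_ofPred_eq, isInM_iff] at hD ⊢
    intro i hi
    exact Subalgebra.smul_mem _ (hD i hi) c
  lie_mem' {D E} hD hE := by
    have hD' : IsInM s D := hD
    have hE' : IsInM s E := hE
    change IsInM s ⁅D, E⁆
    rw [isInM_iff]
    intro i hi
    rw [Derivation.commutator_apply]
    exact sub_mem (hD'.apply_mem ((isInM_iff s E).1 hE' i hi))
      (hE'.apply_mem ((isInM_iff s D).1 hD' i hi))

/-- The Lie ideal `I_s` of `m_s(K)`. -/
def I (K : Type*) [Field K] (n s : ℕ) : LieIdeal K (m K n s) where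
  carrier := {D | IsInI s (D : W K n)}
  add_mem' {D E} hD hE := by
    simp only [Set.mem_ofPred_eq, isInI_iff] at hD hE ⊢
    intro i hi
    simp [hD i hi, hE i hi]
  zero_mem' := by
    simp only [Set.mem_ofPred_eq, isInI_iff]
    intro i _
    simp
  smul_mem' c D hD := by
    simp only [Set.mem_ofPred_eq, isInI_iff] at hD ⊢
    intro i hi
    simp [hD i hi]
  lie_mem {D E} hE := by
    have hE' : IsInI s (E : W K n) := hE
    have hD' : IsInM s (D : W K n) := D.2
    change IsInI s ⁅(D : W K n), (E : W K n)⁆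
    rw [isInI_iff]
    intro i hi
    rw [Derivation.commutator_apply, (isInI_iff s _).1 hE' i hi,
      hE'.apply_eq_zero ((isInM_iff s _).1 hD' i hi), map_zero, sub_zero]

/-- An ideal `J` of a Lie subalgebra `M` of `W_n` is polynomial if, as a subset of `W_n`, it is a
`P_n`-submodule of `W_n`. -/
def IsPolynomialIdeal {K : Type*} [Field K] {n : ℕ} {M : LieSubalgebra K (W K n)}
    (J : LieIdeal K M) : Prop :=
  ∃ N : Submodule (P K n) (W K n), (N : Set (W K n)) = Subtype.val '' (J : Set M)

end PolyVectorFields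

open PolyVectorFields

/-! Bracketing with `∂_l` differentiates every coefficient of a vector field. A set of fields stable
under these brackets and containing a nonzero field therefore contains a nonzero constant one
(`exists_const_of_pderiv_stable`). The other tool is the identity `[D, fE] = D(f)E + f[D, E]`.

Maximality: if `L` strictly contains `m_s`, let `N` be the largest `P_n`-submodule inside `L`. It
contains `I_s` and is normalised by `L`. A field `D` in `L` outside `m_s` has a coefficient at some
`x_i`, `i ≤ s`, that depends on some `x_j`, `j > s`; then `[∂_j, D]` lies in `N` but not in `I_s`.
From it `N` acquires every `∂_k`, so `N = W_n`.

Ideals: a nonzero ideal of `m_s` meets `I_s` nontrivially because the centraliser of `I_s` in `m_s`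
is zero. Passing to constant fields and integrating coefficients, it contains `I_s`. If it is larger
than `I_s`, the same argument on the first `s` coefficients gives all of `m_s`.

Structure: restriction to `P_s` maps `m_s` onto `W_s` with kernel `I_s`. The isomorphism `I_s ≅ P_s
⊗ W_{n-s}` comes from `P_n ≅ P_s ⊗ P_{n-s}`, since elements of `I_s` are `P_s`-linear.

Non-isomorphism: by uniqueness of the ideal, `m_s ≅ m_t` induces `W_s ≅ W_t`. Growth recovers `s`:
`W_s` contains a bracket-generated grid indexed by `ℕ^s`, but none indexed by `ℕ^d` with `d > s`,
because fields of degree at most `N` form a space whose dimension is bounded by a polynomial of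
degree `s` in `N`. -/

namespace PolyVectorFields

/-! ### Partial derivatives of polynomials in characteristic zero -/

section Polynomials

open MvPolynomial

variable {K σ : Type*} [Field K]

lemma totalDegree_pderiv_lt (i : σ) {p : MvPolynomial σ K} (hp : pderiv i p ≠ 0) :
    (pderiv i p).totalDegree < p.totalDegree := by
  obtain ⟨b, hb⟩ := support_nonempty.2 hp
  have key : ∀ b ∈ (pderiv i p).support, b.degree + 1 ≤ p.totalDegree := by
    intro b hb
    have hb' : b + Finsupp.single i 1 ∈ p.support := by
      rw [mem_support_iff, coeff_pderiv] at hb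
      exact mem_support_iff.2 (left_ne_zero_of_mul hb)
    have h : (b + Finsupp.single i 1).degree ≤ p.totalDegree := le_totalDegree hb'
    rwa [map_add, Finsupp.degree_single] at h
  have hpos : 0 < p.totalDegree := (Nat.succ_pos _).trans_le (key b hb)
  rw [totalDegree, Finset.sup_lt_iff hpos]
  exact fun b hb => key b hb

lemma totalDegree_pderiv_le (i : σ) (p : MvPolynomial σ K) :
    (pderiv i p).totalDegree ≤ p.totalDegree := by
  by_cases hp : pderiv i p = 0
  · simp [hp]
  · exact (totalDegree_pderiv_lt i hp).le

variable [CharZero K]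

lemma mem_supported_of_pderiv_eq_zero {S : Set σ} {p : MvPolynomial σ K}
    (hp : ∀ i ∉ S, pderiv i p = 0) : p ∈ supported K S := by
  classical
  rw [mem_supported]
  intro i hi
  by_contra hiS
  obtain ⟨b, hb, hib⟩ := (mem_vars_iff_mem_support i).1 hi
  have hle : Finsupp.single i 1 ≤ b := by
    rw [Finsupp.single_le_iff]
    exact Nat.one_le_iff_ne_zero.2 (Finsupp.mem_support_iff.1 hib)
  have h := congrArg (coeff (b - Finsupp.single i 1)) (hp i hiS)
  rw [coeff_pderiv, tsub_add_cancel_of_le hle, coeff_zero] at h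
  exact (mul_ne_zero (mem_support_iff.1 hb) (Nat.cast_add_one_ne_zero _)) h

lemma eq_C_of_pderiv_eq_zero {p : MvPolynomial σ K} (hp : ∀ i, pderiv i p = 0) :
    ∃ c : K, p = C c := by
  have h : p ∈ supported K (∅ : Set σ) := mem_supported_of_pderiv_eq_zero fun i _ => hp i
  rw [supported_empty, Algebra.mem_bot] at h
  obtain ⟨c, hc⟩ := h
  exact ⟨c, hc.symm⟩

/-- Integration term by term; characteristic zero makes the divisors `b i + 1` invertible. Keeping
the antiderivative in the variables of `S` is what later keeps `q • ∂_k` inside `m_s`. -/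
lemma exists_pderiv_eq {S : Set σ} {i : σ} (hi : i ∈ S) {p : MvPolynomial σ K}
    (hp : p ∈ supported K S) : ∃ q ∈ supported K S, pderiv i q = p := by
  classical
  refine ⟨∑ b ∈ p.support, monomial (b + Finsupp.single i 1) (coeff b p / (b i + 1)),
    sum_mem fun b hb => ?_, ?_⟩
  · rw [mem_supported] at hp ⊢
    intro j hj
    obtain ⟨c, hc, hj⟩ := (mem_vars_iff_mem_support j).1 hj
    have hc := Finset.mem_singleton.1 (support_monomial_subset hc)
    subst hc
    rcases Finset.mem_union.1 (Finsupp.support_add hj) with h | h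
    · exact hp ((mem_vars_iff_mem_support j).2 ⟨b, hb, h⟩)
    · have := Finset.mem_singleton.1 (Finsupp.support_single_subset h)
      exact this ▸ hi
  · rw [map_sum]
    conv_rhs => rw [p.as_sum]
    refine Finset.sum_congr rfl fun b _ => ?_
    have : (b i : K) + 1 ≠ 0 := Nat.cast_add_one_ne_zero _
    rw [pderiv_monomial]
    congr 1
    · simp
    · simp [this]

/-- A set of vectors of polynomials which is stable under all partial derivatives and contains
a nonzero vector contains a nonzero constant vector. -/
lemma exists_const_of_pderiv_stable {ι : Type*} [Fintype ι] (V : Set (ι → MvPolynomial σ K))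
    (hV : ∀ v ∈ V, ∀ l, (fun i => pderiv l (v i)) ∈ V) {v : ι → MvPolynomial σ K} (hv : v ∈ V)
    (h0 : v ≠ 0) : ∃ c : ι → K, c ≠ 0 ∧ (fun i => C (c i)) ∈ V := by
  -- A partial derivative raises the degree of no entry and strictly lowers that of every entry it
  -- does not kill.
  induction hd : ∑ i, (v i).totalDegree using Nat.strong_induction_on generalizing v with
  | _ d ih =>
  by_cases hc : ∀ i l, pderiv l (v i) = 0
  · choose c hc using fun i => eq_C_of_pderiv_eq_zero (hc i)
    refine ⟨c, ?_, ?_⟩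
    · rintro rfl
      exact h0 (funext fun i => by simp [hc i])
    · convert hv using 1
      exact funext fun i => (hc i).symm
  · push Not at hc
    obtain ⟨i, l, hil⟩ := hc
    refine ih _ ?_ (hV v hv l) (fun h => hil (congrFun h i)) rfl
    rw [← hd]
    exact Finset.sum_lt_sum (fun j _ => totalDegree_pderiv_le l (v j))
      ⟨i, Finset.mem_univ i, totalDegree_pderiv_lt l hil⟩

end Polynomials

/-! ### Vector fields, maximality of `m_s`, and its ideals -/

section Derivations

open MvPolynomial

variable {K : Type*} [Field K] {n : ℕ}

lemma lie_smul_derivation (D E : W K n) (f : P K n) : ⁅D, f • E⁆ = D f • E + f • ⁅D, E⁆ := by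
  ext i
  simp only [Derivation.commutator_apply, Derivation.add_apply, Derivation.smul_apply,
    smul_eq_mul, Derivation.leibniz]
  ring_nf

lemma derivation_pderiv_X (D : W K n) (i l : Fin n) : D (pderiv l (X i)) = 0 := by
  rw [pderiv_X]
  by_cases h : i = l
  · subst h; simp
  · simp [h]

lemma lie_pderiv_apply_X (l : Fin n) (D : W K n) (i : Fin n) :
    ⁅(pderiv l : W K n), D⁆ (X i) = pderiv l (D (X i)) := by
  rw [Derivation.commutator_apply, derivation_pderiv_X, sub_zero]

lemma lie_pderiv_pderiv (l k : Fin n) : ⁅(pderiv l : W K n), (pderiv k : W K n)⁆ = 0 :=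
  derivation_ext fun i => by
    rw [lie_pderiv_apply_X, derivation_pderiv_X, Derivation.zero_apply]

lemma lie_pderiv_smul_pderiv (l k : Fin n) (f : P K n) :
    ⁅(pderiv l : W K n), f • (pderiv k : W K n)⁆ = pderiv l f • (pderiv k : W K n) := by
  rw [lie_smul_derivation, lie_pderiv_pderiv, smul_zero, add_zero]

lemma eq_sum_smul_pderiv (D : W K n) : D = ∑ i, D (X i) • (pderiv i : W K n) :=
  derivation_ext fun k => by rw [sum_pderiv_apply_X, if_pos (Finset.mem_univ k)]

lemma smul_pderiv_apply_X (f : P K n) (k i : Fin n) :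
    (f • (pderiv k : W K n)) (X i) = if k = i then f else 0 := by
  rw [Derivation.smul_apply, pderiv_X, Pi.single_apply]
  by_cases h : k = i
  · simp [h]
  · simp [h, Ne.symm h]

variable {s : ℕ}

lemma IsInI.isInM {D : W K n} (h : IsInI s D) : IsInM s D := by
  rw [isInI_iff] at h
  rw [isInM_iff]
  intro i hi
  rw [h i hi]
  exact zero_mem _

lemma IsInI.smul {D : W K n} (h : IsInI s D) (f : P K n) : IsInI s (f • D) := by
  rw [isInI_iff] at h ⊢
  intro i hi
  rw [Derivation.smul_apply, h i hi, smul_zero]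

lemma isInI_smul_pderiv (f : P K n) {k : Fin n} (hk : s ≤ k.val) :
    IsInI s (f • (pderiv k : W K n)) := by
  rw [isInI_iff]
  intro i hi
  rw [smul_pderiv_apply_X, if_neg]
  rintro rfl
  omega

lemma isInM_smul_pderiv {f : P K n} (hf : f ∈ firstVars K n s) (k : Fin n) :
    IsInM s (f • (pderiv k : W K n)) := by
  rw [isInM_iff]
  intro i _
  rw [smul_pderiv_apply_X]
  split_ifs
  · exact hf
  · exact zero_mem _

lemma isInM_pderiv (k : Fin n) : IsInM s (pderiv k : W K n) := by
  simpa using isInM_smul_pderiv (s := s) (one_mem (firstVars K n s)) k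

lemma X_mem_firstVars {i : Fin n} (hi : i.val < s) : (X i : P K n) ∈ firstVars K n s :=
  X_mem_supported.2 hi

lemma mem_m {D : W K n} : D ∈ m K n s ↔ IsInM s D := Iff.rfl

lemma mem_I {D : m K n s} : D ∈ I K n s ↔ IsInI s (D : W K n) := Iff.rfl

lemma m_ne_top (hs : 1 ≤ s) (hsn : s < n) : m K n s ≠ ⊤ := by
  intro h
  have h1 : ((X ⟨s, hsn⟩ : P K n) • (pderiv ⟨0, by omega⟩ : W K n)) ∈ m K n s :=
    h ▸ LieSubalgebra.mem_top _
  have h2 := (isInM_iff _ _).1 (mem_m.1 h1) ⟨0, by omega⟩ hs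
  rw [smul_pderiv_apply_X, if_pos rfl, X_mem_supported] at h2
  exact lt_irrefl s h2

lemma eq_top_of_forall_pderiv_mem {N : Submodule (P K n) (W K n)}
    (h : ∀ k, (pderiv k : W K n) ∈ N) (D : W K n) : D ∈ N := by
  rw [eq_sum_smul_pderiv D]
  exact sum_mem fun k _ => N.smul_mem _ (h k)

theorem isCoatom_m [CharZero K] (hs : 1 ≤ s) (hsn : s < n) : IsCoatom (m K n s) := by
  refine ⟨m_ne_top hs hsn, fun L hL => ?_⟩
  obtain ⟨hle, D, hDL, hDm⟩ := SetLike.lt_iff_le_and_exists.1 hL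
  -- The largest `P_n`-submodule of `W_n` contained in `L`.
  let N : Submodule (P K n) (W K n) :=
    { carrier := {D | ∀ f : P K n, f • D ∈ L}
      add_mem' := fun ha hb f => by rw [smul_add]; exact add_mem (ha f) (hb f)
      zero_mem' := fun f => by rw [smul_zero]; exact zero_mem _
      smul_mem' := fun c x hx f => by rw [smul_smul]; exact hx _ }
  have hN : ∀ {E}, E ∈ N ↔ ∀ f : P K n, f • E ∈ L := Iff.rfl
  have hNL : ∀ {E}, E ∈ N → E ∈ L := fun h => by simpa using hN.1 h 1
  have hNI : ∀ {E : W K n}, IsInI s E → E ∈ N := fun h f => hle (h.smul f).isInM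
  -- `N` is normalised by `L`, since `f[E, F] = [E, fF] - E(f)F`.
  have hlie : ∀ {E F : W K n}, E ∈ L → F ∈ N → ⁅E, F⁆ ∈ N := by
    intro E F hE hF f
    have h := lie_smul_derivation E F f
    rw [← sub_eq_iff_eq_add'] at h
    rw [← h]
    exact sub_mem (L.lie_mem hE (hF f)) (hF _)
  have hdL : ∀ l, (pderiv l : W K n) ∈ L := fun l => hle (isInM_pderiv l)
  rw [mem_m, isInM_iff] at hDm
  push Not at hDm
  obtain ⟨i, hi, hDi⟩ := hDm
  have hj : ∃ j : Fin n, s ≤ j.val ∧ pderiv j (D (X i)) ≠ 0 := by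
    by_contra! h
    exact hDi (mem_supported_of_pderiv_eq_zero fun j hj => h j (not_lt.1 hj))
  obtain ⟨j, hjs, hj⟩ := hj
  have hjN : (pderiv j : W K n) ∈ N := by
    simpa using hNI (isInI_smul_pderiv (s := s) (1 : P K n) hjs)
  have hv : ⁅(pderiv j : W K n), D⁆ ∈ N := by
    rw [← lie_skew]
    exact neg_mem (hlie hDL hjN)
  rw [← lie_pderiv_apply_X] at hj
  generalize ⁅(pderiv j : W K n), D⁆ = v at hv hj
  have hlie' : ∀ {E F : W K n}, E ∈ N → F ∈ L → ⁅E, F⁆ ∈ N := by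
    intro E F hE hF
    rw [← lie_skew]
    exact neg_mem (hlie hF hE)
  -- Since `i ≤ s`, the field `x_i ∂_k` lies in `m_s`, and `v(x_i) ∂_k = [v, x_i ∂_k] - x_i [v,
  -- ∂_k]`. The nonzero polynomial `v(x_i)` can then be differentiated down to a nonzero constant.
  have hvk : ∀ k, v (X i) • (pderiv k : W K n) ∈ N := by
    intro k
    have h := lie_smul_derivation v (pderiv k) (X i)
    rw [← sub_eq_iff_eq_add] at h
    rw [← h]
    exact sub_mem (hlie' hv (hle (isInM_smul_pderiv (X_mem_firstVars hi) k)))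
      (N.smul_mem _ (hlie' hv (hdL k)))
  obtain ⟨c, hc0, hc⟩ := exists_const_of_pderiv_stable
    {w : Unit → P K n | ∀ k, w () • (pderiv k : W K n) ∈ N}
    (fun w hw l k => by
      rw [← lie_pderiv_smul_pderiv]
      exact hlie (hdL l) (hw k))
    (v := fun _ => v (X i)) hvk (fun h => hj (congrFun h ()))
  have hc0 : c () ≠ 0 := fun h => hc0 (funext fun _ => h)
  have hd : ∀ k, (pderiv k : W K n) ∈ N := by
    intro k
    have h := N.smul_mem (C (c ())⁻¹) (hc k)
    rwa [smul_smul, ← C_mul, inv_mul_cancel₀ hc0, C_1, one_smul] at h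
  exact eq_top_iff.2 fun E _ => hNL (eq_top_of_forall_pderiv_mem hd E)

theorem isPolynomialIdeal_I : IsPolynomialIdeal (I K n s) := by
  refine ⟨{ carrier := {D | IsInI s D}
            add_mem' := ?_
            zero_mem' := ?_
            smul_mem' := fun f D hD => hD.smul f }, ?_⟩
  · intro D E hD hE
    rw [Set.mem_ofPred_eq, isInI_iff] at hD hE ⊢
    intro i hi
    simp [hD i hi, hE i hi]
  · rw [Set.mem_ofPred_eq, isInI_iff]
    simp
  · ext D
    exact ⟨fun h => ⟨⟨D, IsInI.isInM h⟩, h, rfl⟩, by rintro ⟨E, hE, rfl⟩; exact hE⟩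

/-! ### Subspaces of `W_n` stable under bracketing with `m_s` -/

section Ideals

variable {A : Submodule K (W K n)}

/-- Since `[I_s, A]` lies in `A ∩ I_s`, a trivial intersection would make every `D` in `A` commute
with `I_s`. Comparing `[D, x_i ∂_{s+1}] = 0` with `[D, ∂_{s+1}] = 0` then gives `D(x_i) = 0` for all
`i`. -/
lemma exists_isInI_mem (hs : s < n) (hA : ∀ D : W K n, D ∈ A → IsInM s D)
    (hlie : ∀ E D : W K n, IsInM s E → D ∈ A → ⁅E, D⁆ ∈ A) (h0 : A ≠ ⊥) :
    ∃ D : W K n, D ∈ A ∧ D ≠ 0 ∧ IsInI s D := by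
  obtain ⟨D, hD, hD0⟩ := A.ne_bot_iff.1 h0
  by_contra! hcon
  have hI : ∀ E : W K n, IsInI s E → ⁅E, D⁆ = 0 := by
    intro E hE
    by_contra hne
    refine hcon _ (hlie E D hE.isInM hD) hne ?_
    rw [isInI_iff]
    intro i hi
    rw [Derivation.commutator_apply, (isInI_iff s E).1 hE i hi, map_zero, sub_zero,
      hE.apply_eq_zero ((isInM_iff s D).1 (hA D hD) i hi)]
  refine hD0 (derivation_ext fun i => ?_)
  have h := lie_smul_derivation D (pderiv ⟨s, hs⟩) (X i)
  have h1 : ⁅D, (pderiv ⟨s, hs⟩ : W K n)⁆ = 0 := by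
    rw [← lie_skew, hI, neg_zero]
    simpa using isInI_smul_pderiv (1 : P K n) (k := ⟨s, hs⟩) le_rfl
  rw [h1, ← lie_skew, hI _ (isInI_smul_pderiv _ le_rfl), neg_zero, smul_zero, add_zero] at h
  have h2 := congrArg (fun E : W K n => E (X ⟨s, hs⟩)) h
  simpa using h2.symm

variable [CharZero K]

/-- Differentiation produces a constant field `D` in `A ∩ I_s` with some coefficient `c_j ≠ 0`, `j >
s`. Then `[D, x_j ∂_k] = c_j ∂_k` puts every `∂_k` with `k > s` in `A`, and `[∂_j, q ∂_k] = (∂_j q)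
∂_k` reaches all coefficients by integration. -/
lemma mem_of_isInI (hlie : ∀ E D : W K n, IsInM s E → D ∈ A → ⁅E, D⁆ ∈ A)
    (h : ∃ D : W K n, D ∈ A ∧ D ≠ 0 ∧ IsInI s D) {E : W K n} (hE : IsInI s E) : E ∈ A := by
  obtain ⟨D, hD, hD0, hDI⟩ := h
  obtain ⟨c, hc0, D, hD, hDI, hDc⟩ := exists_const_of_pderiv_stable
    {v : Fin n → P K n | ∃ D ∈ A, IsInI s D ∧ ∀ i, D (X i) = v i}
    (fun v ⟨D, hD, hDI, hDv⟩ l => ⟨_, hlie (pderiv l) D (isInM_pderiv l) hD, by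
      rw [isInI_iff]
      intro i hi
      rw [lie_pderiv_apply_X, (isInI_iff s D).1 hDI i hi, map_zero], fun i => by
      rw [lie_pderiv_apply_X, hDv]⟩)
    (v := fun i => D (X i)) ⟨D, hD, hDI, fun _ => rfl⟩
    (fun h => hD0 (derivation_ext fun i => congrFun h i))
  obtain ⟨j, hj⟩ := Function.ne_iff.1 hc0
  have hjs : s ≤ j.val := by
    by_contra! hlt
    have := (isInI_iff s D).1 hDI j hlt
    rw [hDc, C_eq_zero] at this
    exact hj this
  have hconst : ∀ k, ⁅(pderiv k : W K n), D⁆ = 0 := fun k => derivation_ext fun i => by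
    rw [lie_pderiv_apply_X, hDc, pderiv_C, Derivation.zero_apply]
  have hd : ∀ k : Fin n, s ≤ k.val → (pderiv k : W K n) ∈ A := by
    intro k hk
    have h := lie_smul_derivation D (pderiv k) (X j)
    rw [← lie_skew D (pderiv k), hconst, neg_zero, smul_zero, add_zero, hDc, ← algebraMap_eq,
      algebraMap_smul] at h
    have h2 : c j • (pderiv k : W K n) ∈ A := by
      rw [← h, ← lie_skew]
      exact neg_mem (hlie _ _ (isInI_smul_pderiv _ hk).isInM hD)
    exact (Submodule.smul_mem_iff _ hj).1 h2
  rw [eq_sum_smul_pderiv E]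
  refine sum_mem fun k _ => ?_
  rcases lt_or_ge k.val s with hk | hk
  · rw [(isInI_iff s E).1 hE k hk, zero_smul]
    exact zero_mem _
  · obtain ⟨q, -, hq⟩ := exists_pderiv_eq (Set.mem_univ j) (p := E (X k)) (by simp)
    rw [← hq, ← lie_pderiv_smul_pderiv, ← lie_skew]
    exact neg_mem (hlie _ _ (isInI_smul_pderiv _ hk).isInM (hd j hjs))

/-- The argument of `mem_of_isInI` run modulo `I_s`: only the first `s` coefficients of `D` become
constant. The error term `x_j [D, ∂_k]` lies in `I_s`, which is a `P_n`-module contained in `A`. -/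
lemma mem_of_isInM (hlie : ∀ E D : W K n, IsInM s E → D ∈ A → ⁅E, D⁆ ∈ A)
    (hI : ∀ E : W K n, IsInI s E → E ∈ A) {D : W K n} (hD : D ∈ A) (hDI : ¬ IsInI s D)
    {E : W K n} (hE : IsInM s E) : E ∈ A := by
  obtain ⟨c, hc0, D, hD, hDc⟩ := exists_const_of_pderiv_stable
    {v : {i : Fin n // i.val < s} → P K n | ∃ D ∈ A, ∀ i : {i : Fin n // i.val < s},
      D (X i.1) = v i}
    (fun v ⟨D, hD, hDv⟩ l => ⟨_, hlie (pderiv l) D (isInM_pderiv l) hD, fun i => by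
      rw [lie_pderiv_apply_X, hDv]⟩)
    (v := fun i => D (X i.1)) ⟨D, hD, fun _ => rfl⟩
    (fun h => hDI ((isInI_iff s D).2 fun i hi => congrFun h ⟨i, hi⟩))
  obtain ⟨j, hj⟩ := Function.ne_iff.1 hc0
  have hd : ∀ k : Fin n, (pderiv k : W K n) ∈ A := by
    intro k
    have hconst : IsInI s ⁅(pderiv k : W K n), D⁆ := by
      rw [isInI_iff]
      intro i hi
      rw [lie_pderiv_apply_X, hDc ⟨i, hi⟩, pderiv_C]
    have h := lie_smul_derivation D (pderiv k) (X j.1)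
    rw [hDc, ← algebraMap_eq, algebraMap_smul, ← sub_eq_iff_eq_add, ← lie_skew D (pderiv k),
      smul_neg, sub_neg_eq_add] at h
    have h2 : c j • (pderiv k : W K n) ∈ A := by
      rw [← h]
      refine add_mem ?_ (hI _ (hconst.smul _))
      rw [← lie_skew]
      exact neg_mem (hlie _ _ (isInM_smul_pderiv (X_mem_firstVars j.2) k) hD)
    exact (Submodule.smul_mem_iff _ hj).1 h2
  rw [eq_sum_smul_pderiv E]
  refine sum_mem fun k _ => ?_
  rcases lt_or_ge k.val s with hk | hk
  · obtain ⟨q, hqs, hq⟩ := exists_pderiv_eq (S := {i : Fin n | i.val < s}) (i := j.1) j.2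
      ((isInM_iff s E).1 hE k hk)
    rw [← hq, ← lie_pderiv_smul_pderiv, ← lie_skew]
    exact neg_mem (hlie _ _ (isInM_smul_pderiv hqs k) (hd j.1))
  · exact hI _ (isInI_smul_pderiv _ hk)

end Ideals

lemma I_ne_bot (hsn : s < n) : I K n s ≠ ⊥ := by
  intro h
  have hmem : IsInI s (pderiv ⟨s, hsn⟩ : W K n) := by
    simpa using isInI_smul_pderiv (1 : P K n) (k := ⟨s, hsn⟩) le_rfl
  have h1 : (⟨_, hmem.isInM⟩ : m K n s) ∈ I K n s := hmem
  rw [h, LieSubmodule.mem_bot] at h1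
  have h2 := congrArg (fun E : m K n s => (E : W K n) (X ⟨s, hsn⟩)) h1
  simp at h2

lemma I_ne_top (hs : 1 ≤ s) (hsn : s < n) : I K n s ≠ ⊤ := by
  intro h
  have h1 : (⟨_, isInM_pderiv ⟨0, by omega⟩⟩ : m K n s) ∈ I K n s := h ▸ LieSubmodule.mem_top _
  have h2 := (isInI_iff _ _).1 (mem_I.1 h1) ⟨0, by omega⟩ hs
  simp at h2

theorem ne_bot_and_ne_top_iff_eq_I [CharZero K] (hs : 1 ≤ s) (hsn : s < n)
    (J : LieIdeal K (m K n s)) : (J ≠ ⊥ ∧ J ≠ ⊤) ↔ J = I K n s := by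
  refine ⟨fun ⟨hbot, htop⟩ => ?_, by rintro rfl; exact ⟨I_ne_bot hsn, I_ne_top hs hsn⟩⟩
  -- The image of `J` in `W_n`, on which the preceding lemmas operate.
  let A : Submodule K (W K n) := J.toSubmodule.map (m K n s).toSubmodule.subtype
  have hAJ : ∀ x : m K n s, (x : W K n) ∈ A ↔ x ∈ J := by
    refine fun x => ⟨?_, fun hx => ⟨x, hx, rfl⟩⟩
    rintro ⟨y, hy, hxy⟩
    rwa [← Subtype.ext hxy]
  have hA : ∀ D : W K n, D ∈ A → IsInM s D := by
    rintro _ ⟨x, -, rfl⟩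
    exact x.2
  have hlie : ∀ E D : W K n, IsInM s E → D ∈ A → ⁅E, D⁆ ∈ A := by
    rintro E _ hE ⟨x, hx, rfl⟩
    exact (hAJ ⁅(⟨E, hE⟩ : m K n s), x⁆).2 (J.lie_mem hx)
  have h0 : A ≠ ⊥ := by
    intro h
    refine hbot ((LieSubmodule.eq_bot_iff J).2 fun x hx => ?_)
    have := (hAJ x).2 hx
    rw [h, Submodule.mem_bot] at this
    exact Subtype.ext this
  have hI : ∀ E : W K n, IsInI s E → E ∈ A := fun E hE =>
    mem_of_isInI hlie (exists_isInI_mem hsn hA hlie h0) hE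
  refine le_antisymm (fun x hx => ?_) (fun x hx => (hAJ x).1 (hI _ hx))
  by_contra hxI
  exact htop (eq_top_iff.2 fun y _ =>
    (hAJ y).1 (mem_of_isInM hlie hI ((hAJ x).2 hx) hxI y.2))

end Derivations

/-! ### Lie algebra maps out of quotients and tensor products -/

open MvPolynomial

lemma nonempty_quotient_lieEquiv {K L M : Type*} [CommRing K] [LieRing L] [LieAlgebra K L]
    [LieRing M] [LieAlgebra K M] (f : L →ₗ⁅K⁆ M) (hf : Function.Surjective f) {J : LieIdeal K L}
    (hJ : ∀ x, x ∈ J ↔ f x = 0) : Nonempty ((L ⧸ J) ≃ₗ⁅K⁆ M) := by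
  obtain rfl : J = f.ker := LieSubmodule.ext _ _ fun x => by rw [hJ, LieHom.mem_ker]
  have hr : f.range = ⊤ := (LieHom.range_eq_top f).2 hf
  exact ⟨(f.quotKerEquivRange.trans (LieEquiv.ofEq f.range ⊤ (by rw [hr]))).trans
    LieSubalgebra.topEquiv⟩

/-- A linear map on `A ⊗ L` which is compatible with the brackets of pure tensors is a
homomorphism of Lie algebras. -/
def lieHomOfTmul {K A L M : Type*} [CommRing K] [CommRing A] [Algebra K A] [LieRing L]
    [LieAlgebra K L] [LieRing M] [LieAlgebra K M] (φ : A ⊗[K] L →ₗ[K] M)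
    (h : ∀ (f g : A) (D E : L), φ ((f * g) ⊗ₜ ⁅D, E⁆) = ⁅φ (f ⊗ₜ D), φ (g ⊗ₜ E)⁆) :
    A ⊗[K] L →ₗ⁅K⁆ M where
  __ := φ
  map_lie' {x y} := by
    change φ _ = ⁅φ x, φ y⁆
    induction x using TensorProduct.induction_on with
    | zero => exact (congrArg φ (zero_lie y)).trans (by rw [map_zero, zero_lie])
    | add x x' hx hx' =>
      exact (congrArg φ (add_lie x x' y)).trans (by rw [map_add, map_add, add_lie, hx, hx'])
    | tmul f D =>
      induction y using TensorProduct.induction_on with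
      | zero =>
        exact (congrArg φ (lie_zero (f ⊗ₜ[K] D))).trans (by rw [map_zero, lie_zero])
      | add y y' hy hy' =>
        exact (congrArg φ (lie_add (f ⊗ₜ[K] D) y y')).trans
          (by rw [map_add, map_add, lie_add, hy, hy'])
      | tmul g E => exact h f g D E

/-! ### The quotient `m_s / I_s` as `W_s` -/

section Quotient

variable {K : Type*} [Field K] {n s : ℕ} (hsn : s ≤ n)

/-- The projection of `P_n` onto `P_s` that sends the variables outside `P_s` to zero. -/
noncomputable def projFirst (K : Type*) [Field K] (n s : ℕ) : P K n →ₐ[K] P K s :=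
  aeval fun i => if h : i.val < s then X ⟨i.val, h⟩ else 0

lemma projFirst_rename (p : P K s) :
    projFirst K n s (rename (Fin.castLE hsn) p) = p := by
  have h : (projFirst K n s).comp (rename (Fin.castLE hsn)) = AlgHom.id K _ := by
    ext i : 1
    simp [projFirst]
  exact DFunLike.congr_fun h p

lemma rename_mem_firstVars (p : P K s) :
    rename (Fin.castLE hsn) p ∈ firstVars K n s := by
  classical
  rw [mem_supported]
  intro i hi
  obtain ⟨j, -, rfl⟩ := Finset.mem_image.1 (vars_rename _ _ hi)
  exact j.2

lemma rename_projFirst {p : P K n} (hp : p ∈ firstVars K n s) :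
    rename (Fin.castLE hsn) (projFirst K n s p) = p := by
  induction hp using Algebra.adjoin_induction with
  | mem x hx =>
    obtain ⟨j, hj, rfl⟩ := hx
    have hj : j.val < s := hj
    simp [projFirst, hj]
  | algebraMap r => simp
  | add x y _ _ hx hy => rw [map_add, map_add, hx, hy]
  | mul x y _ _ hx hy => rw [map_mul, map_mul, hx, hy]

/-- The derivation of `P_s` obtained from a derivation of `P_n` by restricting it to `P_s` and
projecting its values to `P_s`. -/
noncomputable def restrictFirst (D : W K n) : W K s :=
  Derivation.mk' ((projFirst K n s).toLinearMap ∘ₗ (D : P K n →ₗ[K] P K n) ∘ₗ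
      (rename (Fin.castLE hsn)).toLinearMap) fun a b => by
    simp [projFirst_rename]

lemma restrictFirst_apply (D : W K n) (p : P K s) :
    restrictFirst hsn D p = projFirst K n s (D (rename (Fin.castLE hsn) p)) := rfl

/-- The restriction of the derivations in `m_s(K)` to `P_s`. -/
noncomputable def restrictFirstHom : m K n s →ₗ⁅K⁆ W K s where
  toFun D := restrictFirst hsn D
  map_add' D E := by
    ext
    simp [restrictFirst_apply]
  map_smul' c D := by
    ext
    simp [restrictFirst_apply]
  map_lie' {D E} := by
    -- Fields in `m_s` preserve `P_s`, so projecting their values on `P_s` loses nothing and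
    -- restriction respects composition.
    have h : ∀ (D : m K n s) (p : P K s), rename (Fin.castLE hsn) (restrictFirst hsn (D : W K n) p)
        = (D : W K n) (rename (Fin.castLE hsn) p) := fun D p =>
      rename_projFirst hsn (IsInM.apply_mem D.2 (rename_mem_firstVars hsn p))
    refine Derivation.ext fun p => ?_
    rw [Derivation.commutator_apply, restrictFirst_apply hsn _ (restrictFirst hsn (E : W K n) p),
      restrictFirst_apply hsn _ (restrictFirst hsn (D : W K n) p), h, h, ← map_sub]
    rfl

lemma restrictFirstHom_apply (D : m K n s) (p : P K s) :
    (restrictFirstHom hsn : m K n s →ₗ⁅K⁆ W K s) D p = projFirst K n s ((D : W K n) (rename (Fin.castLE hsn) p)) := rfl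

lemma restrictFirstHom_eq_zero_iff (D : m K n s) :
    D ∈ I K n s ↔ (restrictFirstHom hsn : m K n s →ₗ⁅K⁆ W K s) D = 0 := by
  rw [mem_I]
  refine ⟨fun h => Derivation.ext fun p => ?_, fun h => (isInI_iff _ _).2 fun i hi => ?_⟩
  · rw [restrictFirstHom_apply, h.apply_eq_zero (rename_mem_firstVars hsn p), map_zero,
      Derivation.zero_apply]
  · have h1 := congrArg (rename (Fin.castLE hsn)) (DFunLike.congr_fun h (X ⟨i.val, hi⟩))
    rw [restrictFirstHom_apply, rename_projFirst, rename_X] at h1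
    · simpa using h1
    · exact IsInM.apply_mem D.2 (rename_mem_firstVars hsn _)

lemma restrictFirstHom_surjective :
    Function.Surjective (restrictFirstHom hsn : m K n s →ₗ⁅K⁆ W K s) := by
  intro E
  let D : W K n := mkDerivation K fun i =>
    if h : i.val < s then rename (Fin.castLE hsn) (E (X ⟨i.val, h⟩)) else 0
  have hD : D ∈ m K n s := (isInM_iff _ _).2 fun i hi => by
    simp only [D, mkDerivation_X, dif_pos hi]
    exact rename_mem_firstVars hsn _
  refine ⟨⟨D, hD⟩, derivation_ext fun i => ?_⟩
  rw [restrictFirstHom_apply, rename_X]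
  simp only [D, mkDerivation_X]
  rw [dif_pos (by simp), projFirst_rename]
  simp

theorem nonempty_quotient_I_lieEquiv {n s : ℕ} (hsn : s ≤ n) :
    Nonempty ((m K n s ⧸ I K n s) ≃ₗ⁅K⁆ W K s) :=
  nonempty_quotient_lieEquiv _ (restrictFirstHom_surjective hsn)
    (restrictFirstHom_eq_zero_iff hsn)

end Quotient

/-! ### The ideal `I_s` as `P_s ⊗ W_{n-s}` -/

section TensorProduct

variable {K : Type*} [Field K] {n s : ℕ} (hsn : s ≤ n)

/-- The splitting of the `n` indices into the first `s` and the last `n - s`. -/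
def finSplit : Fin s ⊕ Fin (n - s) ≃ Fin n :=
  finSumFinEquiv.trans (finCongr (Nat.add_sub_cancel' hsn))

lemma finSplit_inl_val (i : Fin s) : (finSplit hsn (Sum.inl i)).val = i.val := by
  simp [finSplit]

/-- The inclusion of the polynomials in the last `n - s` variables. -/
noncomputable abbrev renameLast : P K (n - s) →ₐ[K] P K n := rename (finSplit hsn ∘ Sum.inr)

/-- The inclusion of the polynomials in the first `s` variables. -/
noncomputable abbrev renameFirst : P K s →ₐ[K] P K n := rename (finSplit hsn ∘ Sum.inl)

variable (K) in
/-- The decomposition of `P_n` as the tensor product of `P_s` and `P_{n-s}`. -/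
noncomputable def tensorPolyEquiv : P K s ⊗[K] P K (n - s) ≃ₐ[K] P K n :=
  (tensorEquivSum K (Fin s) (Fin (n - s)) K).trans (renameEquiv K (finSplit hsn))

lemma tensorPolyEquiv_tmul (f : P K s) (g : P K (n - s)) :
    tensorPolyEquiv K hsn (f ⊗ₜ g) = renameFirst hsn f * renameLast hsn g := by
  have h1 : (tensorPolyEquiv K hsn).toAlgHom.comp Algebra.TensorProduct.includeLeft
      = renameFirst hsn := by
    ext i : 1
    simp [tensorPolyEquiv]
  have h2 : (tensorPolyEquiv K hsn).toAlgHom.comp Algebra.TensorProduct.includeRight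
      = renameLast hsn := by
    ext i : 1
    simp [tensorPolyEquiv]
  rw [← h1, ← h2]
  simp [← map_mul]

/-- The elements of `I_s` are determined by their values on the last `n - s` variables, which are
arbitrary. -/
noncomputable def IEquivPi : I K n s ≃ₗ[K] (Fin (n - s) → P K n) where
  toFun D j := ((D : m K n s) : W K n) (X (finSplit hsn (Sum.inr j)))
  map_add' D E := rfl
  map_smul' c D := rfl
  invFun v :=
    have h : IsInI s (mkDerivation K (Sum.elim 0 v ∘ (finSplit hsn).symm) : W K n) :=
      (isInI_iff _ _).2 fun i hi => by
        have : i = finSplit hsn (Sum.inl ⟨i.val, hi⟩) := Fin.ext (by simp [finSplit_inl_val])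
        rw [mkDerivation_X, this]
        simp
    ⟨⟨_, h.isInM⟩, h⟩
  left_inv D := by
    refine Subtype.ext (Subtype.ext (derivation_ext fun i => ?_))
    obtain ⟨i, rfl⟩ := (finSplit hsn).surjective i
    rcases i with i | i
    · have := (isInI_iff _ _).1 (mem_I.1 D.2) (finSplit hsn (Sum.inl i))
        (by simp [finSplit_inl_val])
      simp [this]
    · simp
  right_inv v := by
    ext1 j
    simp

variable (K) in
/-- The linear isomorphism underlying `P_s ⊗ W_{n-s} ≃ I_s`. -/
noncomputable def tensorEquivI : P K s ⊗[K] W K (n - s) ≃ₗ[K] I K n s :=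
  ((TensorProduct.congr (LinearEquiv.refl K _) (mkDerivationEquiv K).symm).trans
    ((TensorProduct.piRight K K (P K s) fun _ : Fin (n - s) => P K (n - s)).trans
      (LinearEquiv.piCongrRight fun _ => (tensorPolyEquiv K hsn).toLinearEquiv))).trans
    (IEquivPi hsn).symm

lemma IEquivPi_apply (D : I K n s) (j : Fin (n - s)) :
    IEquivPi hsn D j = ((D : m K n s) : W K n) (X (finSplit hsn (Sum.inr j))) := rfl

lemma tensorEquivI_tmul_X (f : P K s) (D : W K (n - s)) (j : Fin (n - s)) :
    ((tensorEquivI K hsn (f ⊗ₜ D) : m K n s) : W K n) (X (finSplit hsn (Sum.inr j)))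
      = renameFirst hsn f * renameLast hsn (D (X j)) := by
  rw [← IEquivPi_apply, tensorEquivI, LinearEquiv.trans_apply, LinearEquiv.apply_symm_apply,
    ← tensorPolyEquiv_tmul]
  rfl

lemma tensorEquivI_tmul_first (f : P K s) (D : W K (n - s)) (p : P K s) :
    ((tensorEquivI K hsn (f ⊗ₜ D) : m K n s) : W K n) (renameFirst hsn p) = 0 := by
  refine IsInI.apply_eq_zero (mem_I.1 (tensorEquivI K hsn (f ⊗ₜ D)).2) ?_
  have : finSplit hsn ∘ Sum.inl = Fin.castLE hsn := funext fun i =>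
    Fin.ext (by simp [finSplit_inl_val])
  rw [renameFirst, this]
  exact rename_mem_firstVars hsn p

lemma tensorEquivI_tmul_last (f : P K s) (D : W K (n - s)) (p : P K (n - s)) :
    ((tensorEquivI K hsn (f ⊗ₜ D) : m K n s) : W K n) (renameLast hsn p)
      = renameFirst hsn f * renameLast hsn (D p) := by
  induction p using MvPolynomial.induction_on with
  | C a => simp
  | add p q hp hq => simp only [map_add, hp, hq, mul_add]
  | mul_X p i hp =>
    have hX : renameLast hsn (X i : P K (n - s)) = X (finSplit hsn (Sum.inr i)) := rename_X _ _
    rw [map_mul, Derivation.leibniz, Derivation.leibniz, hp, hX, tensorEquivI_tmul_X, ← hX]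
    simp only [smul_eq_mul, map_add, map_mul]
    ring

/-- The tensor `f ⊗ D` acts as `fD`, with `D` extended by zero on `P_s`. In `[fD, gE]` the terms
with `D(g)` and `E(f)` vanish, leaving `fg[D, E]`. -/
lemma tensorEquivI_lie (f g : P K s) (D E : W K (n - s)) :
    tensorEquivI K hsn ((f * g) ⊗ₜ ⁅D, E⁆)
      = ⁅tensorEquivI K hsn (f ⊗ₜ D), tensorEquivI K hsn (g ⊗ₜ E)⁆ := by
  refine (IEquivPi hsn).injective (funext fun j => ?_)
  change ((tensorEquivI K hsn ((f * g) ⊗ₜ[K] ⁅D, E⁆) : m K n s) : W K n) _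
    = (⁅((tensorEquivI K hsn (f ⊗ₜ D) : m K n s) : W K n),
      ((tensorEquivI K hsn (g ⊗ₜ E) : m K n s) : W K n)⁆ : W K n) _
  rw [tensorEquivI_tmul_X, Derivation.commutator_apply, Derivation.commutator_apply,
    tensorEquivI_tmul_X, tensorEquivI_tmul_X, Derivation.leibniz, Derivation.leibniz,
    tensorEquivI_tmul_first, tensorEquivI_tmul_first, tensorEquivI_tmul_last,
    tensorEquivI_tmul_last]
  simp only [smul_eq_mul, map_sub, map_mul]
  ring

theorem nonempty_I_lieEquiv_tensor {n s : ℕ} (hsn : s ≤ n) :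
    Nonempty (I K n s ≃ₗ⁅K⁆ P K s ⊗[K] W K (n - s)) :=
  ⟨(LieEquiv.ofBijective (lieHomOfTmul (tensorEquivI K hsn).toLinearMap (tensorEquivI_lie hsn))
    (tensorEquivI K hsn).bijective).symm⟩

end TensorProduct

/-! ### Growth distinguishes `W_s` from `W_t` -/

section Growth

/-- The Lie algebra `L` contains a linearly independent family indexed by `ℕ^d` in which the step
in the `i`-th direction is, up to a scalar, the bracket with a fixed element. -/
def HasBracketGrid (K L : Type*) [CommRing K] [LieRing L] [LieAlgebra K L] (d : ℕ) : Prop :=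
  ∃ (u : Fin d → L) (F : (Fin d →₀ ℕ) → L), LinearIndependent K F ∧
    ∀ a i, ∃ c : K, F (a + Finsupp.single i 1) = c • ⁅u i, F a⁆

lemma HasBracketGrid.of_lieEquiv {K L M : Type*} [CommRing K] [LieRing L] [LieAlgebra K L]
    [LieRing M] [LieAlgebra K M] {d : ℕ} (h : HasBracketGrid K L d) (e : L ≃ₗ⁅K⁆ M) :
    HasBracketGrid K M d := by
  obtain ⟨u, F, hF, hu⟩ := h
  refine ⟨e ∘ u, e ∘ F, hF.map' e.toLinearEquiv.toLinearMap e.toLinearEquiv.ker, fun a i => ?_⟩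
  obtain ⟨c, hc⟩ := hu a i
  refine ⟨c, ?_⟩
  simp only [Function.comp_apply, hc, map_smul]
  rw [LieEquiv.map_lie]

variable {K : Type*} [Field K] {n : ℕ}

/-- Evaluation of a derivation at a variable, as a linear map. -/
noncomputable def evalX (K : Type*) [Field K] {n : ℕ} (i : Fin n) : W K n →ₗ[K] P K n where
  toFun D := D (X i)
  map_add' _ _ := rfl
  map_smul' _ _ := rfl

/-- The fields `x_i² ∂_i` serve as the grid steps of `hasBracketGrid_W`: each raises one exponent by
one, up to a scalar that must be kept nonzero. -/
lemma lie_sq_smul_pderiv (i j : Fin n) (b : Fin n →₀ ℕ) :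
    ⁅((X i ^ 2 : P K n) • (pderiv i : W K n)), (monomial b (1 : K)) • (pderiv j : W K n)⁆
      = ((b i : K) - if i = j then 2 else 0) •
        ((monomial (b + Finsupp.single i 1) (1 : K)) • (pderiv j : W K n)) := by
  have hX : monomial (b + Finsupp.single i 1) (1 : K) = X i * monomial b 1 := by
    rw [X, monomial_mul, add_comm, one_mul]
  have h2 : ⁅((X i ^ 2 : P K n) • (pderiv i : W K n)), (pderiv j : W K n)⁆
      = -((if i = j then C 2 * X i else 0 : P K n) • (pderiv j : W K n)) := by
    rw [← lie_skew, lie_pderiv_smul_pderiv, pderiv_pow]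
    by_cases h : i = j
    · subst h
      simp [show (C 2 : P K n) = 2 from map_ofNat C 2]
    · simp [h, pderiv_X_of_ne h]
  rw [lie_smul_derivation, h2, hX, Derivation.smul_apply, smul_eq_mul, pow_two, mul_assoc,
    X_mul_pderiv_monomial]
  refine derivation_ext fun k => ?_
  simp only [Derivation.add_apply, Derivation.smul_apply, Derivation.neg_apply, smul_eq_mul]
  rw [← Nat.cast_smul_eq_nsmul K]
  simp only [smul_eq_C_mul]
  split_ifs
  · simp only [map_sub]
    ring
  · simp only [sub_zero]
    ring

lemma hasBracketGrid_W [CharZero K] (hn : 1 ≤ n) : HasBracketGrid K (W K n) n := by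
  let z : Fin n := ⟨0, hn⟩
  -- The scalar of a step is `b_i` or `b_i - 2`; starting all exponents at 3 keeps both nonzero.
  let r : Fin n →₀ ℕ := Finsupp.equivFunOnFinite.symm fun _ => 3
  refine ⟨fun i => (X i ^ 2 : P K n) • (pderiv i : W K n),
    fun a => monomial (a + r) (1 : K) • (pderiv z : W K n), ?_, fun a i => ?_⟩
  · refine LinearIndependent.of_comp (evalX K z) ?_
    have h : evalX K z ∘ (fun a => monomial (a + r) (1 : K) • (pderiv z : W K n))
        = (basisMonomials (Fin n) K) ∘ fun a => a + r := by
      funext a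
      simp [evalX]
    rw [h]
    exact (basisMonomials (Fin n) K).linearIndependent.comp _ (add_left_injective r)
  · have hr : r i = 3 := rfl
    have hne : (((a + r) i : ℕ) : K) - (if i = z then 2 else 0) ≠ 0 := by
      rw [Finsupp.add_apply, hr]
      split_ifs
      · have h : ((a i + 3 : ℕ) : K) - 2 = ((a i + 1 : ℕ) : K) := by
          push_cast
          ring
        rw [h]
        exact Nat.cast_ne_zero.2 (Nat.succ_ne_zero _)
      · rw [sub_zero]
        exact Nat.cast_ne_zero.2 (by omega)
    refine ⟨((((a + r) i : ℕ) : K) - if i = z then 2 else 0)⁻¹, ?_⟩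
    rw [lie_sq_smul_pderiv, smul_smul, inv_mul_cancel₀ hne, one_smul, add_right_comm]

/-- The derivations whose coefficients have total degree at most `N`. -/
def degreeLE (K : Type*) [Field K] (n N : ℕ) : Submodule K (W K n) where
  carrier := {D | ∀ i, (D (X i)).totalDegree ≤ N}
  add_mem' ha hb i := (totalDegree_add _ _).trans (max_le (ha i) (hb i))
  zero_mem' i := by simp
  smul_mem' c D hD i := (totalDegree_smul_le c _).trans (hD i)

lemma exists_mem_degreeLE (D : W K n) : ∃ N, D ∈ degreeLE K n N :=
  ⟨Finset.univ.sup fun i => (D (X i)).totalDegree, fun i =>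
    Finset.le_sup (f := fun i => (D (X i)).totalDegree) (Finset.mem_univ i)⟩

lemma degreeLE_mono {M N : ℕ} (h : M ≤ N) : degreeLE K n M ≤ degreeLE K n N :=
  fun _ hD i => (hD i).trans h

lemma totalDegree_apply_le {N : ℕ} {D : W K n} (hD : D ∈ degreeLE K n N) (p : P K n) :
    (D p).totalDegree ≤ p.totalDegree + N := by
  have h : D p = ∑ i, D (X i) * pderiv i p := by
    conv_lhs => rw [eq_sum_smul_pderiv D]
    rw [← Derivation.coeFnAddMonoidHom_apply, map_sum, Finset.sum_apply]
    rfl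
  rw [h]
  refine totalDegree_finsetSum_le fun i _ => (totalDegree_mul _ _).trans ?_
  rw [add_comm]
  exact add_le_add (totalDegree_pderiv_le i p) (hD i)

lemma lie_mem_degreeLE {M N : ℕ} {D E : W K n} (hD : D ∈ degreeLE K n M)
    (hE : E ∈ degreeLE K n N) : ⁅D, E⁆ ∈ degreeLE K n (M + N) := by
  intro i
  rw [Derivation.commutator_apply]
  refine (totalDegree_sub _ _).trans (max_le ?_ ?_)
  · exact (totalDegree_apply_le hD _).trans (by have := hE i; omega)
  · exact (totalDegree_apply_le hE _).trans (by have := hD i; omega)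

/-- A field of degree at most `N` is determined by its coefficients at the monomials whose exponents
are all at most `N`. This box has `(N + 1)^n` monomials for each of the `n` components; the crude
bound has the right order of growth. -/
lemma card_le_of_linearIndependent_degreeLE {ι : Type*} [Fintype ι] {N : ℕ} {v : ι → W K n}
    (hv : LinearIndependent K v) (hN : ∀ i, v i ∈ degreeLE K n N) :
    Fintype.card ι ≤ n * (N + 1) ^ n := by
  let toF : (Fin n → Fin (N + 1)) → (Fin n →₀ ℕ) := fun b =>
    Finsupp.equivFunOnFinite.symm fun j => (b j).val
  let φ : W K n →ₗ[K] (Fin n × (Fin n → Fin (N + 1)) → K) :=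
    LinearMap.pi fun x => lcoeff K (toF x.2) ∘ₗ evalX K x.1
  have hφ : ∀ D ∈ degreeLE K n N, φ D = 0 → D = 0 := by
    intro D hD h0
    refine derivation_ext fun i => MvPolynomial.ext _ _ fun b => ?_
    rw [Derivation.zero_apply, coeff_zero]
    by_cases hb : ∀ j, b j < N + 1
    · have h1 := congrFun h0 (i, fun j => ⟨b j, hb j⟩)
      have h2 : toF (fun j => ⟨b j, hb j⟩) = b := by
        ext j
        rfl
      change coeff (toF fun j => ⟨b j, hb j⟩) (D (X i)) = 0 at h1
      rwa [h2] at h1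
    · push Not at hb
      obtain ⟨j, hj⟩ := hb
      refine coeff_eq_zero_of_totalDegree_lt ?_
      have h1 : b j ≤ b.degree := Finsupp.le_degree j b
      have h2 : b.degree = ∑ i ∈ b.support, b i := rfl
      have h3 := hD i
      omega
  have hli : LinearIndependent K (φ ∘ v) := by
    refine hv.map (Submodule.disjoint_def.2 fun D hD h0 => hφ D ?_ h0)
    exact (Submodule.span_le.2 (by rintro _ ⟨i, rfl⟩; exact hN i)) hD
  have h := hli.fintype_card_le_finrank
  rwa [Module.finrank_fintype_fun_eq_card, Fintype.card_prod, Fintype.card_fun, Fintype.card_fin,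
    Fintype.card_fin] at h

/-- The grid points in `[0, k]^d` give `(k + 1)^d` independent fields of degree `O(k)`, while the
dimension available is only `O(k^n)`. -/
lemma not_hasBracketGrid_W {d : ℕ} (hd : n < d) : ¬ HasBracketGrid K (W K n) d := by
  rintro ⟨u, F, hF, hu⟩
  obtain ⟨N₀, hN₀⟩ := exists_mem_degreeLE (F 0)
  choose N hN using fun i => exists_mem_degreeLE (u i)
  obtain ⟨N₁, hN₁⟩ : ∃ N₁, ∀ i, u i ∈ degreeLE K n N₁ :=
    ⟨Finset.univ.sup N, fun i => degreeLE_mono (Finset.le_sup (Finset.mem_univ i)) (hN i)⟩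
  -- Each step of the grid is a bracket with some `u i`, so it raises the degree bound by at most
  -- `N₁`.
  have hdeg : ∀ (k : ℕ) (a : Fin d →₀ ℕ), a.degree = k → F a ∈ degreeLE K n (N₀ + k * N₁) := by
    intro k
    induction k with
    | zero =>
      intro a ha
      rw [(Finsupp.degree_eq_zero_iff a).1 ha]
      simpa using hN₀
    | succ k ih =>
      intro a ha
      obtain ⟨i, hi⟩ : ∃ i, a i ≠ 0 := by
        by_contra! h
        rw [show a = 0 from Finsupp.ext h] at ha
        simp at ha
      have hle : Finsupp.single i 1 ≤ a :=
        Finsupp.single_le_iff.2 (Nat.one_le_iff_ne_zero.2 hi)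
      have hk : (a - Finsupp.single i 1).degree = k := by
        have := congrArg Finsupp.degree (tsub_add_cancel_of_le hle)
        rw [map_add, Finsupp.degree_single] at this
        omega
      obtain ⟨c, hc⟩ := hu (a - Finsupp.single i 1) i
      rw [tsub_add_cancel_of_le hle] at hc
      rw [hc]
      refine Submodule.smul_mem _ _ (degreeLE_mono ?_ (lie_mem_degreeLE (hN₁ i) (ih _ hk)))
      exact le_of_eq (by ring)
  have hcard : ∀ k : ℕ, (k + 1) ^ d ≤ n * (N₀ + d * k * N₁ + 1) ^ n := by
    intro k
    let ψ : (Fin d → Fin (k + 1)) → (Fin d →₀ ℕ) := fun b =>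
      Finsupp.equivFunOnFinite.symm fun j => (b j).val
    have hψ : Function.Injective ψ := fun b b' h => funext fun j =>
      Fin.ext (DFunLike.congr_fun h j)
    have h := card_le_of_linearIndependent_degreeLE (hF.comp ψ hψ) (N := N₀ + d * k * N₁)
      fun b => degreeLE_mono (Nat.add_le_add_left (Nat.mul_le_mul_right _ ?_) _)
        (hdeg _ (ψ b) rfl)
    · simpa using h
    · rw [Finsupp.degree_eq_sum]
      calc ∑ j, ψ b j ≤ ∑ _j : Fin d, k :=
            Finset.sum_le_sum fun j _ => Nat.lt_succ_iff.1 (b j).2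
        _ = d * k := by simp
  -- `A` is chosen so that the degree bound plus one is at most `A(k + 1)`. With `k = n A^n` the
  -- count then gives `(k + 1)^(n + 1) ≤ k (k + 1)^n`, which is absurd.
  set A := N₀ + d * N₁ + 1 with hA
  set k := n * A ^ n with hk
  have h := hcard k
  have h1 : N₀ + d * k * N₁ + 1 ≤ A * (k + 1) := by
    rw [hA]
    nlinarith [Nat.zero_le (N₀ * k), Nat.zero_le (d * N₁)]
  have h2 : (k + 1) ^ (n + 1) ≤ (k + 1) ^ d := Nat.pow_le_pow_right (Nat.succ_pos k) hd
  have h3 : (k + 1) * (k + 1) ^ n ≤ k * (k + 1) ^ n :=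
    calc (k + 1) * (k + 1) ^ n = (k + 1) ^ (n + 1) := by ring
      _ ≤ n * (N₀ + d * k * N₁ + 1) ^ n := h2.trans h
      _ ≤ n * (A * (k + 1)) ^ n := Nat.mul_le_mul_left _ (Nat.pow_le_pow_left h1 n)
      _ = k * (k + 1) ^ n := by rw [mul_pow, ← mul_assoc]
  have h4 := Nat.le_of_mul_le_mul_right h3 (Nat.pow_pos (Nat.succ_pos k))
  omega

theorem eq_of_W_lieEquiv [CharZero K] {s t : ℕ} (hs : 1 ≤ s) (ht : 1 ≤ t)
    (e : W K s ≃ₗ⁅K⁆ W K t) : s = t := by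
  by_contra hne
  rcases lt_or_gt_of_ne hne with h | h
  · exact not_hasBracketGrid_W h ((hasBracketGrid_W ht).of_lieEquiv e.symm)
  · exact not_hasBracketGrid_W h ((hasBracketGrid_W hs).of_lieEquiv e)

end Growth

/-- The composite `m_s ≅ m_t → W_t` is surjective, and its kernel is the preimage of `I_t`, a
nontrivial ideal. By uniqueness this kernel is `I_s`, so `W_s ≅ m_s / I_s ≅ W_t`. -/
theorem eq_of_m_lieEquiv {K : Type*} [Field K] [CharZero K] {n s t : ℕ} (hs : 1 ≤ s) (hsn : s < n)
    (ht : 1 ≤ t) (htn : t < n) (e : m K n s ≃ₗ⁅K⁆ m K n t) : s = t := by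
  let f : m K n s →ₗ⁅K⁆ W K t := (restrictFirstHom htn.le).comp e.toLieHom
  have hf : ∀ x, f x = 0 ↔ e x ∈ I K n t := fun x =>
    (restrictFirstHom_eq_zero_iff htn.le (e x)).symm
  have hker : f.ker = I K n s := by
    refine (ne_bot_and_ne_top_iff_eq_I hs hsn f.ker).1 ⟨fun h => ?_, fun h => ?_⟩
    · refine I_ne_bot (K := K) htn ((LieSubmodule.eq_bot_iff _).2 fun y hy => ?_)
      have hy' : e.symm y ∈ f.ker := by
        rw [LieHom.mem_ker, hf, LieEquiv.apply_symm_apply]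
        exact hy
      rw [h, LieSubmodule.mem_bot] at hy'
      rw [← e.apply_symm_apply y, hy', map_zero]
    · refine I_ne_top (K := K) ht htn (eq_top_iff.2 fun y _ => ?_)
      have hy' : e.symm y ∈ f.ker := h ▸ LieSubmodule.mem_top _
      rwa [LieHom.mem_ker, hf, LieEquiv.apply_symm_apply] at hy'
  obtain ⟨e₁⟩ := nonempty_quotient_lieEquiv f
    ((restrictFirstHom_surjective htn.le).comp e.surjective) (J := I K n s)
    fun x => by rw [← hker, LieHom.mem_ker]
  obtain ⟨e₂⟩ := nonempty_quotient_I_lieEquiv (K := K) hsn.le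
  exact eq_of_W_lieEquiv hs ht (e₂.symm.trans e₁)

end PolyVectorFields

theorem theorem1 (K : Type*) [Field K] [IsAlgClosed K] [CharZero K] (n : ℕ) :
    (∀ s : ℕ, 1 ≤ s → s < n →
      IsCoatom (m K n s) ∧
      (IsPolynomialIdeal (I K n s) ∧
        Nonempty (I K n s ≃ₗ⁅K⁆ P K s ⊗[K] W K (n - s)) ∧
        Nonempty ((m K n s ⧸ I K n s) ≃ₗ⁅K⁆ W K s)) ∧
      (∀ J : LieIdeal K (m K n s), (J ≠ ⊥ ∧ J ≠ ⊤) ↔ J = I K n s)) ∧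
    (∀ s t : ℕ, 1 ≤ s → s < n → 1 ≤ t → t < n → s ≠ t →
      IsEmpty (m K n s ≃ₗ⁅K⁆ m K n t)) :=
  ⟨fun _ hs hsn => ⟨isCoatom_m hs hsn,
    ⟨isPolynomialIdeal_I, nonempty_I_lieEquiv_tensor hsn.le, nonempty_quotient_I_lieEquiv hsn.le⟩,
    ne_bot_and_ne_top_iff_eq_I hs hsn⟩,
  fun _ _ hs hsn ht htn hst => ⟨fun e => hst (eq_of_m_lieEquiv hs hsn ht htn e)⟩⟩
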